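/- Let $\Omega\subset\mathbb R^2$ be open (for instance a convex domain) and let $\hat f:\mathbb R^2\to\mathbb R$ be a smooth function whose support is compact and contained in $\Omega$. Let $p$ be the solution, in the sense of distributions, of the initial value problem for the three-dimensional wave equation $$\partial_{tt}p(\xi,z;t)=\Delta_{\xi,z}\,p(\xi,z;t)\quad(t>0),\qquad p(\xi,z;0)=\hat f(\xi)\,\delta(z),\qquad \partial_tp(\xi,z;0)=0,\qquad \xi\in\mathbb R^2,\ z\in\mathbb R;$$ that is, $p$ is a distribution on $\mathbb R^3\times\mathbb R$ which vanishes on $\{t<0\}$ and satisfies $\partial_{tt}p-\Delta p=\hat f(\xi)\delta(z)\otimes\delta'(t)$, i.e. $$\langle p,\ \partial_{tt}\psi-\Delta\psi\rangle=-\int_{\mathbb R^2}\hat f(\xi)\,\partial_t\psi(\xi,0;0)\,d\xi\qquad\text{for all }\psi\in C_c^\infty(\mathbb R^3\times\mathbb R).$$ For $\xi\in\mathbb R^2$ and $r\ge 0$ let $$\mathcal M_2[\hat f](\xi;r)=\frac1{2\pi}\int_{S^1}\hat f(\xi+r\theta)\,ds(\theta)$$ denote the circular mean of $\hat f$. Then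 for every $\xi\in\partial\Omega$ and every $t>0$ the distribution $p$ is a continuous function in a neighbourhood of $(\xi,0;t)$, so that the in-plane point-detector data $m_2(\xi;t):=p(\xi,0;t)$ are well defined; the function $s\mapsto m_2(\xi;s)$ is integrable on $(0,t)$; and $$\mathcal M_2[\hat f](\xi;t)=2\int_0^t m_2(\xi;s)\,ds .$$ Consequently the recovery of $\hat f$ from the data $m_2$ is reduced to inverting the circular mean transform: if $R$ is any map that recovers every smooth function $g$ with compact support in $\Omega$ from its circular means $(\mathcal M_2[g](\xi;t))_{\xi\in\partial\Omega,\,t>0}$, then applying $R$ to the function $(\xi,t)\mapsto 2\int_0^t m_2(\xi;s)\,ds$ on $\partial\Omega\times(0,\infty)$ gives $\hat f$. -/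

import Mathlib

open MeasureTheory Set TopologicalSpace
open scoped Distributions LineDeriv ContDiff

noncomputable section

namespace Photoacoustic

/-- The illumination plane, with points `ξ`. -/
abbrev Plane : Type := EuclideanSpace ℝ (Fin 2)

/-- Physical space, with points `x = (ξ, z)`. -/
abbrev Space : Type := EuclideanSpace ℝ (Fin 3)

/-- Space-time, with points `(x, t)`. -/
abbrev SpaceTime : Type := Space × ℝ

/-- The point `(ξ, z)` of space. -/
def spacePoint (ξ : Plane) (z : ℝ) : Space := !₂[ξ 0, ξ 1, z]

/-- Real distributions on all of space-time. -/
abbrev SpaceTimeDistribution : Type := 𝓓'((⊤ : Opens SpaceTime), ℝ)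

/-- The spherical mean `M_n[f](x; r) = |S^{n-1}|⁻¹ ∫_{S^{n-1}} f (x + r θ) ds(θ)`. -/
def sphericalMean {n : ℕ} (f : EuclideanSpace ℝ (Fin n) → ℝ)
    (x : EuclideanSpace ℝ (Fin n)) (r : ℝ) : ℝ :=
  ((volume : Measure (EuclideanSpace ℝ (Fin n))).toSphere.real univ)⁻¹ *
    ∫ θ : Metric.sphere (0 : EuclideanSpace ℝ (Fin n)) 1,
      f (x + r • (θ : EuclideanSpace ℝ (Fin n)))
        ∂(volume : Measure (EuclideanSpace ℝ (Fin n))).toSphere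

/-- The unit vector of space-time in the time direction. -/
def timeDir : SpaceTime := (0, 1)

/-- The unit vector of space-time in the `i`-th spatial direction. -/
def spaceDir (i : Fin 3) : SpaceTime := (EuclideanSpace.single i 1, 0)

/-- `∂_{tt} p - Δ_x p`, with distributional derivatives. -/
def dAlembertian (p : SpaceTimeDistribution) : SpaceTimeDistribution :=
  ∂_{timeDir} (∂_{timeDir} p) - ∑ i : Fin 3, ∂_{spaceDir i} (∂_{spaceDir i} p)

/-- The pairing `⟨f(ξ) δ(z), φ⟩ = ∫_{ℝ²} f(ξ) φ(ξ, 0) dξ` of the layer with density `f` on the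
plane `z = 0` with a function `φ` on space. -/
def sheet (f : Plane → ℝ) (φ : Space → ℝ) : ℝ :=
  ∫ ξ : Plane, f ξ * φ (spacePoint ξ 0)

/-- `p` is the solution, in the sense of distributions, of the initial value problem
`∂_{tt} p = Δ p` for `t > 0`, `p(ξ, z; 0) = f(ξ) δ(z)`, `∂_t p(ξ, z; 0) = 0`. As usual for
distributional Cauchy problems `p` is extended by zero to `t < 0`, and the initial values
are encoded as the jumps at `t = 0`: `∂_{tt} p - Δ p = f(ξ) δ(z) ⊗ δ'(t)` on space-time. -/
structure IsPressureWave (f : Plane → ℝ) (p : SpaceTimeDistribution) : Prop where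
  eq_zero_of_neg : ∀ ψ : 𝓓((⊤ : Opens SpaceTime), ℝ),
    tsupport ψ ⊆ {y : SpaceTime | y.2 < 0} → p ψ = 0
  wave_eq : ∀ ψ : 𝓓((⊤ : Opens SpaceTime), ℝ),
    dAlembertian p ψ = - sheet f (fun x : Space => (∂_{timeDir} ψ) (x, (0 : ℝ)))

/-- Near the point `y` the distribution `p` is a continuous function, whose value at `y`
is `v`. -/
def HasPointValue (p : SpaceTimeDistribution) (y : SpaceTime) (v : ℝ) : Prop :=
  ∃ (U : Set SpaceTime) (g : SpaceTime → ℝ), IsOpen U ∧ y ∈ U ∧ ContinuousOn g U ∧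
    (∀ ψ : 𝓓((⊤ : Opens SpaceTime), ℝ), tsupport ψ ⊆ U → p ψ = ∫ w : SpaceTime, g w * ψ w) ∧
    g y = v

open Classical in
/-- The value of `p` at `y`, when it has one (and `0` otherwise). -/
def pointValue (p : SpaceTimeDistribution) (y : SpaceTime) : ℝ :=
  if h : ∃ v : ℝ, HasPointValue p y v then h.choose else 0

/-- The point detector data `m₂(ξ; t) = p(ξ, 0; t)`. -/
def pointData (p : SpaceTimeDistribution) (ξ : Plane) (t : ℝ) : ℝ :=
  pointValue p (spacePoint ξ 0, t)

end Photoacoustic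

end

noncomputable section

open Filter
open scoped Topology Convolution

namespace Photoacoustic

/-! The proof is by duality. The advanced potential `Φ(w) = (4π)⁻¹ ∫ |y|⁻¹ ψ(w + (y, |y|)) dy` is
smooth, commutes with derivatives and satisfies `□Φ = ψ` (`potential_waveOp`, `fderiv_potential`).
Its support is bounded towards the future, so cutting it off in `-2 < t < -1` yields an admissible
test function. The cutoff error lies in `t ≤ -1`, where `p` vanishes, so the wave equation
determines `p`: `⟨p, ψ⟩ = -∫ f ∂ₜΦ(ξ, 0; 0) dξ` (`IsPressureWave.apply_eq`).

For `ψ` supported in `|z| < t`, swap the integrals, use polar coordinates in the plane around the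
projection of `x`, and substitute `t = √(r² + z²)`. The Jacobian absorbs the factor `|y|⁻¹`, and an
integration by parts in `t` shows that `p` is the continuous function `½ ∂ₜ M₂[f](ξ; √(t² - z²))`
there (`IsPressureWave.apply_eq_integral`).

On `z = 0` this gives `m₂ = ½ ∂ₜ M₂[f]`, hence `2 ∫₀ᵗ m₂ = M₂[f](ξ; t) - f(ξ)`. The last term
vanishes on `∂Ω`, since `Ω` is open and contains the support of `f`. The reduction to an inverse of
the circular means follows because both data functions coincide. -/

/-! ### Derivatives of test functions. -/

theorem lineDerivOp_eq_fderiv (ψ : 𝓓((⊤ : Opens SpaceTime), ℝ)) (v w : SpaceTime) :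
    (∂_{v} ψ) w = fderiv ℝ ψ w v := by
  change TestFunction.lineDerivCLM ℝ v ψ w = _
  rw [TestFunction.lineDerivCLM_apply_of_le (by simp)]
  exact ((ψ.contDiff.differentiable (by simp)) w).lineDeriv_eq_fderiv

theorem hasFDerivAt_testFunction (ψ : 𝓓((⊤ : Opens SpaceTime), ℝ)) (w : SpaceTime) :
    HasFDerivAt ψ (fderiv ℝ ψ w) w :=
  ((ψ.contDiff.differentiable (by simp)) w).hasFDerivAt

theorem lineDerivOp_comm (ψ : 𝓓((⊤ : Opens SpaceTime), ℝ)) (v v' w : SpaceTime) :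
    (∂_{v} (∂_{v'} ψ)) w = (∂_{v'} (∂_{v} ψ)) w := by
  have key : ∀ a b : SpaceTime, (∂_{a} (∂_{b} ψ)) w = fderiv ℝ (fderiv ℝ ψ) w a b := by
    intro a b
    rw [lineDerivOp_eq_fderiv]
    have h : ((∂_{b} ψ : 𝓓((⊤ : Opens SpaceTime), ℝ)) : SpaceTime → ℝ) = fun z => fderiv ℝ ψ z b := by
      ext z; exact lineDerivOp_eq_fderiv ψ b z
    have hd : DifferentiableAt ℝ (fderiv ℝ ψ) w :=
      ((ψ.contDiff.fderiv_right (m := ∞) (by simp)).differentiable (by simp)) w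
    rw [h]
    simpa using congrArg (fun L => L a) (fderiv_clm_apply hd (differentiableAt_const b))
  rw [key, key]
  refine (ψ.contDiff.contDiffAt.isSymmSndFDerivAt ?_).eq v v'
  rw [minSmoothness_of_isRCLikeNormedField]
  exact WithTop.coe_le_coe.2 le_top

/-! ### The divergence identity on the hyperboloid `t = √(|y|² + ε²)`. -/

/-- The distance of `y` from the origin, regularised at scale `ε`. -/
def coneDist (ε : ℝ) (y : Space) : ℝ := √(‖y‖ ^ 2 + ε ^ 2)

theorem coneDist_zero (y : Space) : coneDist 0 y = ‖y‖ := by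
  simp [coneDist]

theorem coneDist_sq (ε : ℝ) (y : Space) : coneDist ε y ^ 2 = ‖y‖ ^ 2 + ε ^ 2 :=
  Real.sq_sqrt (by positivity)

theorem coneDist_pos {ε : ℝ} (hε : 0 < ε) (y : Space) : 0 < coneDist ε y :=
  Real.sqrt_pos.2 (by positivity)

theorem norm_le_coneDist (ε : ℝ) (y : Space) : ‖y‖ ≤ coneDist ε y :=
  Real.le_sqrt_of_sq_le (by nlinarith [sq_nonneg ε])

theorem le_coneDist {ε : ℝ} (y : Space) : ε ≤ coneDist ε y :=
  Real.le_sqrt_of_sq_le (by nlinarith [sq_nonneg ‖y‖])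

theorem hasDerivAt_coneDist {ε : ℝ} (hε : 0 < ε) (y : Space) (i : Fin 3) :
    HasDerivAt (fun s : ℝ => coneDist ε (y + s • EuclideanSpace.single i 1))
      (y i / coneDist ε y) 0 := by
  have h1 : HasDerivAt (fun s : ℝ => y + s • (EuclideanSpace.single i 1 : Space))
      (EuclideanSpace.single i 1) 0 := by
    simpa using ((hasDerivAt_id (0 : ℝ)).smul_const (EuclideanSpace.single i (1:ℝ) : Space)).const_add y
  have h2 := ((h1.norm_sq).add_const (ε ^ 2)).sqrt (by positivity)
  refine h2.congr_deriv ?_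
  rw [zero_smul, add_zero, EuclideanSpace.inner_single_right]
  simp only [coneDist, one_mul, conj_trivial]
  rw [mul_div_mul_left _ _ two_ne_zero]

theorem hasDerivAt_comp_cone (χ : 𝓓((⊤ : Opens SpaceTime), ℝ)) (w : SpaceTime) {ε : ℝ} (hε : 0 < ε)
    (y : Space) (i : Fin 3) :
    HasDerivAt (fun s : ℝ => χ (w + (y + s • EuclideanSpace.single i 1,
        coneDist ε (y + s • EuclideanSpace.single i 1))))
      ((∂_{spaceDir i} χ) (w + (y, coneDist ε y)) +
        y i / coneDist ε y * (∂_{timeDir} χ) (w + (y, coneDist ε y))) 0 := by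
  have h1 : HasDerivAt (fun s : ℝ => y + s • (EuclideanSpace.single i 1 : Space))
      (EuclideanSpace.single i 1) 0 := by
    simpa using ((hasDerivAt_id (0 : ℝ)).smul_const (EuclideanSpace.single i (1:ℝ) : Space)).const_add y
  have h2 := ((h1.prodMk (hasDerivAt_coneDist hε y i)).const_add w)
  have h3 := (hasFDerivAt_testFunction χ (w + (y, coneDist ε y)))
  have h4 := HasFDerivAt.comp_hasDerivAt_of_eq (0:ℝ) h3 h2 (by simp)
  refine h4.congr_deriv ?_
  rw [lineDerivOp_eq_fderiv, lineDerivOp_eq_fderiv, ← smul_eq_mul, ← map_smul, ← map_add]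
  simp [spaceDir, timeDir]

theorem exists_bound_support (χ : 𝓓((⊤ : Opens SpaceTime), ℝ)) :
    ∃ R : ℝ, 0 < R ∧ ∀ w : SpaceTime, R < ‖w‖ → χ w = 0 := by
  obtain ⟨R, hR, h⟩ := χ.hasCompactSupport.isCompact.isBounded.exists_pos_norm_le
  refine ⟨R, hR, fun w hw => ?_⟩
  by_contra hne
  exact absurd (h w (subset_tsupport _ hne)) (not_le.2 hw)

theorem exists_bound_support_cone (χ : 𝓓((⊤ : Opens SpaceTime), ℝ)) (w : SpaceTime) :
    ∃ R : ℝ, 0 < R ∧ ∀ (y : Space) (t : ℝ), R < ‖y‖ → χ (w + (y, t)) = 0 := by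
  obtain ⟨R, hR, h⟩ := exists_bound_support χ
  refine ⟨R + ‖w‖, by positivity, fun y t hy => h _ ?_⟩
  have h1 : ‖y‖ ≤ ‖((y, t) : SpaceTime)‖ := norm_fst_le (y, t)
  have h2 : ‖((y, t) : SpaceTime)‖ ≤ ‖w + (y, t)‖ + ‖w‖ := by
    simpa using norm_sub_le (w + (y, t)) w
  linarith

theorem exists_bound_testFunction (χ : 𝓓((⊤ : Opens SpaceTime), ℝ)) :
    ∃ C : ℝ, 0 ≤ C ∧ ∀ w : SpaceTime, |χ w| ≤ C := by
  obtain ⟨C, hC⟩ := χ.continuous.bounded_above_of_compact_support χ.hasCompactSupport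
  exact ⟨C, (norm_nonneg _).trans (hC 0), hC⟩

theorem continuous_comp_cone (χ : 𝓓((⊤ : Opens SpaceTime), ℝ)) (w : SpaceTime) (ε : ℝ) :
    Continuous fun y : Space => χ (w + (y, coneDist ε y)) := by
  have h : Continuous fun y : Space => coneDist ε y := by unfold coneDist; fun_prop
  fun_prop

theorem integrable_mul_comp_cone (χ : 𝓓((⊤ : Opens SpaceTime), ℝ)) (w : SpaceTime) (ε : ℝ)
    {c : Space → ℝ} (hc : Continuous c) :
    Integrable fun y : Space => c y * χ (w + (y, coneDist ε y)) := by
  obtain ⟨R, hR, h⟩ := exists_bound_support_cone χ w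
  refine (hc.mul (continuous_comp_cone χ w ε)).integrable_of_hasCompactSupport ?_
  refine HasCompactSupport.intro (isCompact_closedBall (0 : Space) R) fun y hy => ?_
  simp only [Pi.mul_apply]
  rw [h y _ (by simpa using hy), mul_zero]

theorem continuous_coneDist_right (ε : ℝ) : Continuous (coneDist ε) := by
  unfold coneDist; fun_prop

/-- The integrand is the `i`-th partial derivative of the integrable field component `W` below, so
it integrates to zero. `W` is chosen so that in its derivative the mixed derivatives of `ψ` and the
first spatial derivatives cancel. -/
theorem integral_divergence_component (ψ : 𝓓((⊤ : Opens SpaceTime), ℝ)) (w : SpaceTime) {ε : ℝ}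
    (hε : 0 < ε) (i : Fin 3) :
    ∫ y : Space, (y i ^ 2 / coneDist ε y ^ 3 * (∂_{timeDir} (∂_{timeDir} ψ)) (w + (y, coneDist ε y))
      + (1 / coneDist ε y ^ 2 - 3 * y i ^ 2 / coneDist ε y ^ 4) *
          (∂_{timeDir} ψ) (w + (y, coneDist ε y))
      - 1 / coneDist ε y * (∂_{spaceDir i} (∂_{spaceDir i} ψ)) (w + (y, coneDist ε y))
      - (1 / coneDist ε y ^ 3 - 3 * y i ^ 2 / coneDist ε y ^ 5) * ψ (w + (y, coneDist ε y))) = 0 := by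
  set D : Space → ℝ := fun y =>
    (y i ^ 2 / coneDist ε y ^ 3 * (∂_{timeDir} (∂_{timeDir} ψ)) (w + (y, coneDist ε y))
      + (1 / coneDist ε y ^ 2 - 3 * y i ^ 2 / coneDist ε y ^ 4) *
          (∂_{timeDir} ψ) (w + (y, coneDist ε y))
      - 1 / coneDist ε y * (∂_{spaceDir i} (∂_{spaceDir i} ψ)) (w + (y, coneDist ε y))
      - (1 / coneDist ε y ^ 3 - 3 * y i ^ 2 / coneDist ε y ^ 5) * ψ (w + (y, coneDist ε y))) with hD
  set W : Space → ℝ := fun y =>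
    y i / coneDist ε y ^ 2 * (∂_{timeDir} ψ) (w + (y, coneDist ε y))
      - 1 / coneDist ε y * (∂_{spaceDir i} ψ) (w + (y, coneDist ε y))
      - y i / coneDist ε y ^ 3 * ψ (w + (y, coneDist ε y)) with hW
  have hc := continuous_coneDist_right ε
  have hpos : ∀ y : Space, coneDist ε y ≠ 0 := fun y => (coneDist_pos hε y).ne'
  have hpow : ∀ (n : ℕ) (y : Space), coneDist ε y ^ n ≠ 0 := fun n y => pow_ne_zero n (hpos y)
  have hi : Continuous fun y : Space => y i := by fun_prop
  have hDint : Integrable D := by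
    refine (((integrable_mul_comp_cone _ w ε ?_).add (integrable_mul_comp_cone _ w ε ?_)).sub
      (integrable_mul_comp_cone _ w ε ?_)).sub (integrable_mul_comp_cone _ w ε ?_)
    · exact (hi.pow 2).div (hc.pow 3) (hpow 3)
    · exact (continuous_const.div (hc.pow 2) (hpow 2)).sub
        ((continuous_const.mul (hi.pow 2)).div (hc.pow 4) (hpow 4))
    · exact continuous_const.div hc hpos
    · exact (continuous_const.div (hc.pow 3) (hpow 3)).sub
        ((continuous_const.mul (hi.pow 2)).div (hc.pow 5) (hpow 5))
  have hWint : Integrable W := by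
    refine ((integrable_mul_comp_cone _ w ε ?_).sub (integrable_mul_comp_cone _ w ε ?_)).sub
      (integrable_mul_comp_cone _ w ε ?_)
    · exact hi.div (hc.pow 2) (hpow 2)
    · exact continuous_const.div hc hpos
    · exact hi.div (hc.pow 3) (hpow 3)
  have hderiv : ∀ y : Space, HasLineDerivAt ℝ W (D y) y (EuclideanSpace.single i 1) := by
    intro y
    have hyi : HasDerivAt (fun s : ℝ => (y + s • (EuclideanSpace.single i 1 : Space)) i) 1 0 := by
      simpa using (hasDerivAt_id (0 : ℝ)).const_add (y i)
    have hρ := hasDerivAt_coneDist hε y i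
    have h0 : y + (0 : ℝ) • (EuclideanSpace.single i 1 : Space) = y := by simp
    have hp' : coneDist ε (y + (0 : ℝ) • (EuclideanSpace.single i 1 : Space)) ≠ 0 := hpos _
    have hT := ((hyi.div (hρ.pow 2) (pow_ne_zero 2 hp')).mul
      (hasDerivAt_comp_cone (∂_{timeDir} ψ) w hε y i)).sub
      (((hasDerivAt_const (0 : ℝ) (1 : ℝ)).div hρ hp').mul
        (hasDerivAt_comp_cone (∂_{spaceDir i} ψ) w hε y i))
    have hT' := hT.sub ((hyi.div (hρ.pow 3) (pow_ne_zero 3 hp')).mul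
        (hasDerivAt_comp_cone ψ w hε y i))
    refine hT'.congr_deriv ?_
    simp only [Pi.pow_apply, Pi.div_apply, h0, hD]
    rw [lineDerivOp_comm ψ (spaceDir i) timeDir]
    have := hpos y
    field_simp
    ring
  -- Integration by parts against the constant function `1`.
  have := integral_bilinear_hasLineDerivAt_right_eq_neg_left_of_integrable
    (μ := (volume : Measure Space)) (f := fun _ => (1 : ℝ)) (f' := fun _ => (0 : ℝ)) (g := W)
    (g' := D) (v := EuclideanSpace.single i 1) (B := ContinuousLinearMap.mul ℝ ℝ)
    (by simp) (by simpa using hDint) (by simpa using hWint)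
    (fun x _ => hasDerivAt_const (0 : ℝ) (1 : ℝ)) (fun x _ => hderiv x)
  simpa using this

/-- The wave operator on test functions. -/
def waveOp (ψ : 𝓓((⊤ : Opens SpaceTime), ℝ)) : 𝓓((⊤ : Opens SpaceTime), ℝ) :=
  ∂_{timeDir} (∂_{timeDir} ψ) - ∑ i : Fin 3, ∂_{spaceDir i} (∂_{spaceDir i} ψ)

theorem testFunction_sum_apply {ι : Type*} (s : Finset ι)
    (ψ : ι → 𝓓((⊤ : Opens SpaceTime), ℝ)) (w : SpaceTime) : (∑ i ∈ s, ψ i) w = ∑ i ∈ s, ψ i w := by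
  classical
  induction s using Finset.induction_on with
  | empty => simp
  | insert a s ha ih => rw [Finset.sum_insert ha, Finset.sum_insert ha, ← ih]; rfl

theorem waveOp_apply (ψ : 𝓓((⊤ : Opens SpaceTime), ℝ)) (w : SpaceTime) :
    waveOp ψ w = (∂_{timeDir} (∂_{timeDir} ψ)) w -
      ∑ i : Fin 3, (∂_{spaceDir i} (∂_{spaceDir i} ψ)) w := by
  rw [← testFunction_sum_apply]; rfl

theorem dAlembertian_apply (p : SpaceTimeDistribution) (ψ : 𝓓((⊤ : Opens SpaceTime), ℝ)) :
    dAlembertian p ψ = p (waveOp ψ) := by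
  have h : ∀ v : SpaceTime, (∂_{v} (∂_{v} p)) ψ = p (∂_{v} (∂_{v} ψ)) := by
    intro v
    simp
  have h2 : dAlembertian p ψ = (∂_{timeDir} (∂_{timeDir} p)) ψ -
      ∑ i : Fin 3, (∂_{spaceDir i} (∂_{spaceDir i} p)) ψ := by
    simp [dAlembertian]
  rw [h2, waveOp, map_sub, map_sum]
  simp only [h]

/-- Sum the divergence identity over `i` and insert `|y|² = ρ² - ε²`, with `ρ = coneDist ε y`: the
terms without `ε²` form `ρ⁻¹ □ψ`, and the others are the three errors on the right. -/
theorem integral_waveOp_regularized (ψ : 𝓓((⊤ : Opens SpaceTime), ℝ)) (w : SpaceTime) {ε : ℝ}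
    (hε : 0 < ε) :
    ∫ y : Space, 1 / coneDist ε y * (waveOp ψ) (w + (y, coneDist ε y)) =
      (∫ y : Space, ε ^ 2 / coneDist ε y ^ 3 *
        (∂_{timeDir} (∂_{timeDir} ψ)) (w + (y, coneDist ε y))) -
      3 * (∫ y : Space, ε ^ 2 / coneDist ε y ^ 4 * (∂_{timeDir} ψ) (w + (y, coneDist ε y))) +
      3 * ∫ y : Space, ε ^ 2 / coneDist ε y ^ 5 * ψ (w + (y, coneDist ε y)) := by
  have hc := continuous_coneDist_right ε
  have hpos : ∀ y : Space, coneDist ε y ≠ 0 := fun y => (coneDist_pos hε y).ne'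
  have hpow : ∀ (n : ℕ) (y : Space), coneDist ε y ^ n ≠ 0 := fun n y => pow_ne_zero n (hpos y)
  have hi : ∀ i : Fin 3, Continuous fun y : Space => y i := fun i => by fun_prop
  have hint : ∀ i ∈ (Finset.univ : Finset (Fin 3)), Integrable fun y : Space =>
    (y i ^ 2 / coneDist ε y ^ 3 * (∂_{timeDir} (∂_{timeDir} ψ)) (w + (y, coneDist ε y))
      + (1 / coneDist ε y ^ 2 - 3 * y i ^ 2 / coneDist ε y ^ 4) *
          (∂_{timeDir} ψ) (w + (y, coneDist ε y))
      - 1 / coneDist ε y * (∂_{spaceDir i} (∂_{spaceDir i} ψ)) (w + (y, coneDist ε y))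
      - (1 / coneDist ε y ^ 3 - 3 * y i ^ 2 / coneDist ε y ^ 5) * ψ (w + (y, coneDist ε y))) := by
    intro i _
    refine (((integrable_mul_comp_cone _ w ε ?_).add (integrable_mul_comp_cone _ w ε ?_)).sub
      (integrable_mul_comp_cone _ w ε ?_)).sub (integrable_mul_comp_cone _ w ε ?_)
    · exact ((hi i).pow 2).div (hc.pow 3) (hpow 3)
    · exact (continuous_const.div (hc.pow 2) (hpow 2)).sub
        ((continuous_const.mul ((hi i).pow 2)).div (hc.pow 4) (hpow 4))
    · exact continuous_const.div hc hpos
    · exact (continuous_const.div (hc.pow 3) (hpow 3)).sub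
        ((continuous_const.mul ((hi i).pow 2)).div (hc.pow 5) (hpow 5))
  have hsum := integral_finsetSum (μ := (volume : Measure Space)) _ hint
  simp only [integral_divergence_component ψ w hε, Finset.sum_const_zero] at hsum
  have h1 := integrable_mul_comp_cone (waveOp ψ) w ε
    (c := fun y => 1 / coneDist ε y) (continuous_const.div hc hpos)
  have h2 := integrable_mul_comp_cone (∂_{timeDir} (∂_{timeDir} ψ)) w ε
    (c := fun y => ε ^ 2 / coneDist ε y ^ 3) (continuous_const.div (hc.pow 3) (hpow 3))
  have h3 := integrable_mul_comp_cone (∂_{timeDir} ψ) w ε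
    (c := fun y => ε ^ 2 / coneDist ε y ^ 4) (continuous_const.div (hc.pow 4) (hpow 4))
  have h4 := integrable_mul_comp_cone ψ w ε
    (c := fun y => ε ^ 2 / coneDist ε y ^ 5) (continuous_const.div (hc.pow 5) (hpow 5))
  have h5 : Integrable fun y : Space =>
      ε ^ 2 / coneDist ε y ^ 3 * (∂_{timeDir} (∂_{timeDir} ψ)) (w + (y, coneDist ε y)) -
        3 * (ε ^ 2 / coneDist ε y ^ 4 * (∂_{timeDir} ψ) (w + (y, coneDist ε y))) :=
    h2.sub (h3.const_mul 3)
  have h6 : Integrable fun y : Space =>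
      ε ^ 2 / coneDist ε y ^ 3 * (∂_{timeDir} (∂_{timeDir} ψ)) (w + (y, coneDist ε y)) -
        3 * (ε ^ 2 / coneDist ε y ^ 4 * (∂_{timeDir} ψ) (w + (y, coneDist ε y))) +
        3 * (ε ^ 2 / coneDist ε y ^ 5 * ψ (w + (y, coneDist ε y))) :=
    h5.add (h4.const_mul 3)
  rw [← integral_const_mul, ← integral_const_mul, ← integral_sub h2 (h3.const_mul 3),
    ← integral_add h5 (h4.const_mul 3), ← sub_eq_zero, ← integral_sub h1 h6]
  rw [← hsum]
  congr 1
  ext y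
  have hn : y 0 ^ 2 + y 1 ^ 2 + y 2 ^ 2 = coneDist ε y ^ 2 - ε ^ 2 := by
    rw [coneDist_sq, EuclideanSpace.norm_sq_eq, Fin.sum_univ_three]
    simp
  rw [waveOp_apply, Fin.sum_univ_three, Fin.sum_univ_three]
  have h0 : y 0 ^ 2 = coneDist ε y ^ 2 - ε ^ 2 - y 1 ^ 2 - y 2 ^ 2 := by linarith
  rw [h0]
  have := hpos y
  field_simp
  ring

/-! ### The limit `ε → 0` on the light cone. -/

theorem integrableOn_inv_norm_pow {R : ℝ} {k : ℕ} (hk : k ≤ 2) :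
    IntegrableOn (fun y : Space => (‖y‖ ^ k)⁻¹) (Metric.ball 0 R) := by
  rw [integrableOn_fun_norm_addHaar volume (f := fun r => (r ^ k)⁻¹)]
  have hd : Module.finrank ℝ Space - 1 = 2 := by simp
  rw [hd]
  have h : IntegrableOn (fun r : ℝ => r ^ (2 - k)) (Ioo 0 R) :=
    (Continuous.integrableOn_Icc (by fun_prop)).mono_set Ioo_subset_Icc_self
  refine h.congr_fun (fun r hr => ?_) measurableSet_Ioo
  have : r ≠ 0 := hr.1.ne'
  simp only [smul_eq_mul]
  rw [pow_sub₀ r this hk]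

theorem integrable_indicator_inv_norm_pow (C R : ℝ) {k : ℕ} (hk : k ≤ 2) :
    Integrable ((Metric.ball (0 : Space) R).indicator fun y => C * (‖y‖ ^ k)⁻¹) :=
  (integrable_indicator_iff measurableSet_ball).2 ((integrableOn_inv_norm_pow hk).const_mul C)

/-- Dominated convergence, with majorant `C |y|⁻ᵏ` on a ball; `k ≤ 2` makes it integrable in
dimension three. -/
theorem tendsto_integral_cone (χ : 𝓓((⊤ : Opens SpaceTime), ℝ)) (w : SpaceTime) {k : ℕ}
    (hk : k ≤ 2) {c : ℝ → Space → ℝ} {c₀ : Space → ℝ}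
    (hc : ∀ ε > 0, Continuous (c ε))
    (hle : ∀ ε > 0, ∀ y ≠ 0, |c ε y| ≤ (‖y‖ ^ k)⁻¹)
    (hlim : ∀ y ≠ 0, Tendsto (fun ε => c ε y) (𝓝[>] 0) (𝓝 (c₀ y))) :
    Tendsto (fun ε => ∫ y : Space, c ε y * χ (w + (y, coneDist ε y))) (𝓝[>] 0)
      (𝓝 (∫ y : Space, c₀ y * χ (w + (y, ‖y‖)))) := by
  obtain ⟨R, hR, hsupp⟩ := exists_bound_support_cone χ w
  obtain ⟨C, hC0, hC⟩ := exists_bound_testFunction χ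
  have h0 : ∀ᵐ y : Space, y ≠ 0 := by simp [ae_iff]
  refine tendsto_integral_filter_of_dominated_convergence
    ((Metric.ball (0 : Space) (R + 1)).indicator fun y => C * (‖y‖ ^ k)⁻¹) ?_ ?_
    (integrable_indicator_inv_norm_pow C (R + 1) hk) ?_
  · filter_upwards [self_mem_nhdsWithin] with ε hε
    exact ((hc ε hε).mul (continuous_comp_cone χ w ε)).aestronglyMeasurable
  · filter_upwards [self_mem_nhdsWithin] with ε hε
    filter_upwards [h0] with y hy0
    by_cases hy : y ∈ Metric.ball (0 : Space) (R + 1)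
    · rw [indicator_of_mem hy, norm_mul, mul_comm]
      exact mul_le_mul (hC _) (hle ε hε y hy0) (norm_nonneg _) hC0
    · rw [indicator_of_notMem hy, hsupp y _ ?_, mul_zero, norm_zero]
      simp only [Metric.mem_ball, dist_zero_right, not_lt] at hy
      linarith
  · filter_upwards [h0] with y hy
    refine (hlim y hy).mul ?_
    have h1 : Continuous fun ε : ℝ => χ (w + (y, coneDist ε y)) := by
      have : Continuous fun ε : ℝ => coneDist ε y := by unfold coneDist; fun_prop
      fun_prop
    have h2 := (h1.tendsto 0).mono_left (nhdsWithin_le_nhds (s := Ioi 0))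
    simpa only [coneDist_zero] using h2

theorem tendsto_coneDist (y : Space) : Tendsto (fun ε => coneDist ε y) (𝓝[>] 0) (𝓝 ‖y‖) := by
  have h : Continuous fun ε : ℝ => coneDist ε y := by unfold coneDist; fun_prop
  simpa only [coneDist_zero] using (h.tendsto 0).mono_left (nhdsWithin_le_nhds (s := Ioi 0))

theorem tendsto_sq_div_coneDist {y : Space} (hy : y ≠ 0) (m : ℕ) :
    Tendsto (fun ε => ε ^ 2 / coneDist ε y ^ m) (𝓝[>] 0) (𝓝 0) := by
  have h1 : Tendsto (fun ε : ℝ => ε ^ 2) (𝓝[>] 0) (𝓝 0) := by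
    have : Continuous fun ε : ℝ => ε ^ 2 := by fun_prop
    simpa using (this.tendsto 0).mono_left (nhdsWithin_le_nhds (s := Ioi 0))
  have h2 := h1.div ((tendsto_coneDist y).pow m) (pow_ne_zero m (norm_ne_zero_iff.2 hy))
  rw [zero_div] at h2
  exact h2

theorem sq_div_coneDist_le {ε : ℝ} (hε : 0 < ε) (y : Space) (k : ℕ) :
    |ε ^ 2 / coneDist ε y ^ (k + 2)| ≤ (coneDist ε y ^ k)⁻¹ := by
  have hp := coneDist_pos hε y
  rw [abs_of_nonneg (by positivity), pow_add, div_mul_eq_div_div_swap]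
  rw [div_eq_mul_inv]
  refine mul_le_of_le_one_left (by positivity) ?_
  rw [div_le_one (by positivity)]
  exact pow_le_pow_left₀ hε.le (le_coneDist y) 2

theorem integrable_inv_coneDist_one_pow_five :
    Integrable fun y : Space => (coneDist 1 y ^ 5)⁻¹ := by
  have h := integrable_rpow_neg_one_add_norm_sq (E := Space) (μ := volume) (r := 5) (by simp; norm_num)
  refine h.congr (Eventually.of_forall fun y => ?_)
  simp only [coneDist, one_pow]
  rw [Real.sqrt_eq_rpow, ← Real.rpow_natCast _ 5, ← Real.rpow_mul (by positivity),
    ← Real.rpow_neg (by positivity), add_comm]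
  norm_num

theorem integral_inv_coneDist_one_pow_five :
    3 * ∫ y : Space, (coneDist 1 y ^ 5)⁻¹ = 4 * Real.pi := by
  have h := integral_fun_norm_addHaar (volume : Measure Space)
    (fun r : ℝ => (√(r ^ 2 + 1) ^ 5)⁻¹)
  have hint : IntegrableOn (fun r : ℝ => r ^ 2 * (√(r ^ 2 + 1) ^ 5)⁻¹) (Ioi 0) := by
    have := (integrable_fun_norm_addHaar (volume : Measure Space)
      (f := fun r : ℝ => (√(r ^ 2 + 1) ^ 5)⁻¹)).1
      (by simpa [coneDist] using integrable_inv_coneDist_one_pow_five)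
    simpa using this
  -- An explicit primitive of the radial integrand; it rises from `0` to `1/3`.
  have hder : ∀ r : ℝ, HasDerivAt (fun r : ℝ => (r / √(r ^ 2 + 1)) ^ 3 / 3)
      (r ^ 2 * (√(r ^ 2 + 1) ^ 5)⁻¹) r := by
    intro r
    have hpos : 0 < r ^ 2 + 1 := by positivity
    have hs : 0 < √(r ^ 2 + 1) := Real.sqrt_pos.2 hpos
    have h1 : HasDerivAt (fun r : ℝ => √(r ^ 2 + 1)) (r / √(r ^ 2 + 1)) r := by
      refine ((((hasDerivAt_id r).pow 2).add_const 1).sqrt hpos.ne').congr_deriv ?_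
      simp
      field_simp
    refine ((((hasDerivAt_id r).div h1 hs.ne').pow 3).div_const 3).congr_deriv ?_
    have hsq : √(r ^ 2 + 1) ^ 2 = r ^ 2 + 1 := Real.sq_sqrt hpos.le
    simp only [id, Pi.div_apply]
    field_simp
    rw [div_pow, hsq]
    norm_num
    field_simp
  have hlim : Tendsto (fun r : ℝ => (r / √(r ^ 2 + 1)) ^ 3 / 3) atTop (𝓝 (1 / 3)) := by
    have h1 : Tendsto (fun r : ℝ => r / √(r ^ 2 + 1)) atTop (𝓝 1) := by
      have h2 : Tendsto (fun r : ℝ => (√(1 + (r ^ 2)⁻¹))⁻¹) atTop (𝓝 1) := by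
        have h3 : Tendsto (fun r : ℝ => (r ^ 2)⁻¹) atTop (𝓝 0) :=
          tendsto_inv_atTop_zero.comp (tendsto_pow_atTop two_ne_zero)
        simpa using ((h3.const_add 1).sqrt).inv₀ (by simp)
      refine h2.congr' ?_
      filter_upwards [eventually_gt_atTop 0] with r hr
      have : r ^ 2 + 1 = r ^ 2 * (1 + (r ^ 2)⁻¹) := by field_simp
      rw [this, Real.sqrt_mul (by positivity), Real.sqrt_sq hr.le]
      field_simp
    simpa using (h1.pow 3).div_const 3
  have hI := integral_Ioi_of_hasDerivAt_of_tendsto' (a := 0) (fun r _ => hder r) hint hlim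
  have hvol : (volume : Measure Space).real (Metric.ball 0 1) = Real.pi * 4 / 3 := by
    rw [Measure.real, EuclideanSpace.volume_ball_fin_three]
    simp
    positivity
  have hd : Module.finrank ℝ Space = 3 := by simp
  rw [hd, hvol] at h
  simp only [smul_eq_mul, Nat.add_one_sub_one, hI, nsmul_eq_mul] at h
  simp only [coneDist, one_pow, h]
  norm_num
  ring

/-- The weight `ε² / ρ⁵` is an approximate identity: under `y ↦ ε y` it becomes independent of `ε`,
while the argument of `χ` tends to `w`. -/
theorem tendsto_integral_dirac (χ : 𝓓((⊤ : Opens SpaceTime), ℝ)) (w : SpaceTime) :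
    Tendsto (fun ε => ∫ y : Space, ε ^ 2 / coneDist ε y ^ 5 * χ (w + (y, coneDist ε y))) (𝓝[>] 0)
      (𝓝 ((∫ y : Space, (coneDist 1 y ^ 5)⁻¹) * χ w)) := by
  obtain ⟨C, hC0, hC⟩ := exists_bound_testFunction χ
  have hscale : ∀ ε > (0 : ℝ), ∫ y : Space, ε ^ 2 / coneDist ε y ^ 5 * χ (w + (y, coneDist ε y)) =
      ∫ y : Space, (coneDist 1 y ^ 5)⁻¹ * χ (w + (ε • y, ε * coneDist 1 y)) := by
    intro ε hε
    have h := Measure.integral_comp_smul (volume : Measure Space)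
      (fun y => ε ^ 2 / coneDist ε y ^ 5 * χ (w + (y, coneDist ε y))) ε
    have hd : Module.finrank ℝ Space = 3 := by simp
    rw [hd, smul_eq_mul, abs_of_pos (by positivity)] at h
    have h2 : ∀ y : Space, coneDist ε (ε • y) = ε * coneDist 1 y := by
      intro y
      rw [coneDist, coneDist, norm_smul, Real.norm_of_nonneg hε.le,
        show (ε * ‖y‖) ^ 2 + ε ^ 2 = ε ^ 2 * (‖y‖ ^ 2 + 1 ^ 2) by ring,
        Real.sqrt_mul (by positivity), Real.sqrt_sq hε.le]
    have h3 : ∫ y : Space, ε ^ 2 / coneDist ε y ^ 5 * χ (w + (y, coneDist ε y)) =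
        ε ^ 3 * ∫ y : Space, ε ^ 2 / coneDist ε (ε • y) ^ 5 *
          χ (w + (ε • y, coneDist ε (ε • y))) := by
      rw [h]; field_simp
    rw [h3, ← integral_const_mul]
    congr 1
    ext y
    rw [h2]
    have := coneDist_pos one_pos y
    field_simp
  have hmain : Tendsto (fun ε : ℝ =>
      ∫ y : Space, (coneDist 1 y ^ 5)⁻¹ * χ (w + (ε • y, ε * coneDist 1 y))) (𝓝[>] 0)
      (𝓝 (∫ y : Space, (coneDist 1 y ^ 5)⁻¹ * χ w)) := by
    refine tendsto_integral_filter_of_dominated_convergence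
      (fun y => (coneDist 1 y ^ 5)⁻¹ * C) ?_ ?_
      (integrable_inv_coneDist_one_pow_five.mul_const C) ?_
    · refine Eventually.of_forall fun ε => Continuous.aestronglyMeasurable ?_
      have hc := continuous_coneDist_right 1
      refine (((hc.pow 5).inv₀ fun y => (pow_pos (coneDist_pos one_pos y) 5).ne')).mul ?_
      fun_prop
    · refine Eventually.of_forall fun ε => Eventually.of_forall fun y => ?_
      have := coneDist_pos one_pos y
      rw [norm_mul, Real.norm_of_nonneg (by positivity)]
      exact mul_le_mul_of_nonneg_left (hC _) (by positivity)
    · refine Eventually.of_forall fun y => Tendsto.const_mul _ ?_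
      have h1 : Continuous fun ε : ℝ => χ (w + (ε • y, ε * coneDist 1 y)) := by fun_prop
      have h2 := (h1.tendsto 0).mono_left (nhdsWithin_le_nhds (s := Ioi 0))
      have h3 : w + ((0 : Space), (0 : ℝ)) = w := add_zero w
      simpa [h3] using h2
  rw [integral_mul_const] at hmain
  refine hmain.congr' ?_
  filter_upwards [self_mem_nhdsWithin] with ε hε
  exact (hscale ε hε).symm

/-- In the regularised identity the errors with `ρ³` and `ρ⁴` are dominated by `|y|⁻¹` and `|y|⁻²`
and vanish. The one with `ρ⁵` would need `|y|⁻³`, which is not integrable at `0`; it leaves the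
point mass `4π`. -/
theorem integral_waveOp_cone (ψ : 𝓓((⊤ : Opens SpaceTime), ℝ)) (w : SpaceTime) :
    ∫ y : Space, ‖y‖⁻¹ * (waveOp ψ) (w + (y, ‖y‖)) = 4 * Real.pi * ψ w := by
  have hc := continuous_coneDist_right
  have hinv : ∀ ε > (0 : ℝ), ∀ y : Space, y ≠ 0 → ∀ k : ℕ,
      (coneDist ε y ^ k)⁻¹ ≤ (‖y‖ ^ k)⁻¹ := by
    intro ε hε y hy k
    have := norm_pos_iff.2 hy
    gcongr
    exact norm_le_coneDist ε y
  have hL : Tendsto (fun ε => ∫ y : Space, 1 / coneDist ε y * (waveOp ψ) (w + (y, coneDist ε y)))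
      (𝓝[>] 0) (𝓝 (∫ y : Space, ‖y‖⁻¹ * (waveOp ψ) (w + (y, ‖y‖)))) := by
    refine tendsto_integral_cone (waveOp ψ) w (k := 1) one_le_two
      (fun ε hε => continuous_const.div (hc ε) fun y => (coneDist_pos hε y).ne') ?_ ?_
    · intro ε hε y hy
      have := coneDist_pos hε y
      rw [abs_of_pos (by positivity), one_div]
      simpa using hinv ε hε y hy 1
    · intro y hy
      simpa only [one_div] using (tendsto_coneDist y).inv₀ (norm_ne_zero_iff.2 hy)
  have hR : ∀ (χ : 𝓓((⊤ : Opens SpaceTime), ℝ)) (k : ℕ), k ≤ 2 →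
      Tendsto (fun ε => ∫ y : Space, ε ^ 2 / coneDist ε y ^ (k + 2) * χ (w + (y, coneDist ε y)))
      (𝓝[>] 0) (𝓝 0) := by
    intro χ k hk
    have := tendsto_integral_cone χ w hk (c := fun ε y => ε ^ 2 / coneDist ε y ^ (k + 2))
      (c₀ := fun _ => 0)
      (fun ε hε => continuous_const.div ((hc ε).pow _) fun y => (pow_pos (coneDist_pos hε y) _).ne')
      (fun ε hε y hy => (sq_div_coneDist_le hε y k).trans (hinv ε hε y hy k))
      (fun y hy => tendsto_sq_div_coneDist hy _)
    simpa using this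
  have hsum := ((hR (∂_{timeDir} (∂_{timeDir} ψ)) 1 one_le_two).sub
    ((hR (∂_{timeDir} ψ) 2 le_rfl).const_mul 3)).add ((tendsto_integral_dirac ψ w).const_mul 3)
  have heq := tendsto_nhds_unique hL (hsum.congr' (by
    filter_upwards [self_mem_nhdsWithin] with ε hε
    exact (integral_waveOp_regularized ψ w hε).symm))
  rw [heq, ← integral_inv_coneDist_one_pow_five]
  ring

/-! ### The advanced potential. -/

/-- The measure `‖y‖⁻¹ dy` on the backward light cone with vertex `0`. -/
def coneMeasure : Measure SpaceTime :=
  Measure.map (fun y : Space => (-y, -‖y‖))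
    ((volume : Measure Space).withDensity fun y => ENNReal.ofReal ‖y‖⁻¹)

theorem measurable_cone : Measurable fun y : Space => ((-y, -‖y‖) : SpaceTime) :=
  Continuous.measurable (by fun_prop)

instance : IsLocallyFiniteMeasure coneMeasure := by
  refine ⟨fun x => ⟨Metric.ball 0 (‖x‖ + 1), Metric.isOpen_ball.mem_nhds (by simp), ?_⟩⟩
  rw [coneMeasure, Measure.map_apply measurable_cone measurableSet_ball]
  refine (measure_mono (t := Metric.ball (0 : Space) (‖x‖ + 1)) ?_).trans_lt ?_
  · intro y hy
    simp only [mem_preimage, mem_ball_zero_iff] at hy ⊢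
    refine lt_of_le_of_lt ?_ hy
    exact (norm_neg y).symm.le.trans (norm_fst_le ((-y, -‖y‖) : SpaceTime))
  · rw [withDensity_apply _ measurableSet_ball]
    have h := (integrableOn_inv_norm_pow (R := ‖x‖ + 1) (k := 1) one_le_two).2
    rw [hasFiniteIntegral_iff_ofReal (Eventually.of_forall fun y => by positivity)] at h
    simpa using h

theorem integral_coneMeasure {F : SpaceTime → ℝ} (hF : Continuous F) :
    ∫ z, F z ∂coneMeasure = ∫ y : Space, ‖y‖⁻¹ * F (-y, -‖y‖) := by
  rw [coneMeasure, integral_map measurable_cone.aemeasurable hF.aestronglyMeasurable,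
    integral_withDensity_eq_integral_toReal_smul (by fun_prop)
      (Eventually.of_forall fun y => ENNReal.ofReal_lt_top)]
  congr 1
  ext y
  rw [ENNReal.toReal_ofReal (by positivity), smul_eq_mul]

/-- The advanced potential of `ψ`. -/
def potential (ψ : 𝓓((⊤ : Opens SpaceTime), ℝ)) (w : SpaceTime) : ℝ :=
  (4 * Real.pi)⁻¹ * ∫ y : Space, ‖y‖⁻¹ * ψ (w + (y, ‖y‖))

/-- Writing the potential as a convolution with a locally finite measure supplies its smoothness and
its derivatives. The cone is backward because convolution evaluates `ψ (w - z)`. -/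
theorem potential_eq_convolution (ψ : 𝓓((⊤ : Opens SpaceTime), ℝ)) :
    potential ψ = fun w => (4 * Real.pi)⁻¹ *
      ((fun _ => (1 : ℝ)) ⋆[ContinuousLinearMap.mul ℝ ℝ, coneMeasure] ψ) w := by
  ext w
  rw [potential, convolution_def]
  simp only [ContinuousLinearMap.mul_apply', one_mul]
  rw [integral_coneMeasure (F := fun t => ψ (w - t)) (by fun_prop)]
  congr 3
  ext y
  congr 2
  rw [sub_eq_add_neg]
  simp

theorem contDiff_potential (ψ : 𝓓((⊤ : Opens SpaceTime), ℝ)) : ContDiff ℝ ∞ (potential ψ) := by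
  rw [potential_eq_convolution]
  exact contDiff_const.mul (ψ.hasCompactSupport.contDiff_convolution_right _
    (locallyIntegrable_const 1) ψ.contDiff)

theorem fderiv_potential (ψ : 𝓓((⊤ : Opens SpaceTime), ℝ)) (w v : SpaceTime) :
    fderiv ℝ (potential ψ) w v = potential (∂_{v} ψ) w := by
  have hl : LocallyIntegrable (fun _ : SpaceTime => (1 : ℝ)) coneMeasure :=
    locallyIntegrable_const 1
  have hd : ∀ q : ℝ × SpaceTime, HasFDerivAt (fun q : ℝ × SpaceTime => ψ q.2)
      ((fderiv ℝ ψ q.2).comp (ContinuousLinearMap.snd ℝ ℝ SpaceTime)) q := fun q =>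
    (hasFDerivAt_testFunction ψ q.2).comp q hasFDerivAt_snd
  -- The real parameter is a dummy, on which nothing depends.
  have h := hasFDerivAt_convolution_right_with_param (ContinuousLinearMap.mul ℝ ℝ)
    (g := fun (_ : ℝ) (z : SpaceTime) => ψ z) (s := univ) isOpen_univ
    ψ.hasCompactSupport.isCompact (fun _ x _ hx => image_eq_zero_of_notMem_tsupport hx) hl
    ((ψ.contDiff.comp contDiff_snd).of_le (by simp)).contDiffOn ((0 : ℝ), w) (mem_univ _)
  have h' : HasFDerivAt (fun x : SpaceTime => ((0 : ℝ), x))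
      (ContinuousLinearMap.inr ℝ ℝ SpaceTime) w := hasFDerivAt_prodMk_right 0 w
  have h2 := (h.comp w h').const_mul (4 * Real.pi)⁻¹
  rw [potential_eq_convolution ψ, potential_eq_convolution (∂_{v} ψ)]
  refine (congrArg (fun L => L v) h2.fderiv).trans ?_
  simp only [smul_apply, smul_eq_mul, ContinuousLinearMap.comp_apply,
    ContinuousLinearMap.inr_apply]
  have hu : (fun x : SpaceTime => fderiv ℝ (Function.HasUncurry.uncurry
      fun (_ : ℝ) (z : SpaceTime) => ψ z) ((0 : ℝ), x)) = fun x =>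
      (fderiv ℝ ψ x).comp (ContinuousLinearMap.snd ℝ ℝ SpaceTime) := by
    ext1 x
    exact (hd (0, x)).fderiv
  rw [hu, convolution_precompR_apply (ContinuousLinearMap.mul ℝ ℝ)
    (g := fun x => (fderiv ℝ ψ x).comp (ContinuousLinearMap.snd ℝ ℝ SpaceTime)) hl
    ((ψ.hasCompactSupport.fderiv ℝ).comp_left (g := fun L : SpaceTime →L[ℝ] ℝ =>
      L.comp (ContinuousLinearMap.snd ℝ ℝ SpaceTime)) (by simp))
    ((ψ.contDiff.continuous_fderiv (by simp)).clm_comp continuous_const)]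
  congr 3

theorem integrable_cone (χ : 𝓓((⊤ : Opens SpaceTime), ℝ)) (w : SpaceTime) :
    Integrable fun y : Space => ‖y‖⁻¹ * χ (w + (y, ‖y‖)) := by
  obtain ⟨R, hR, hsupp⟩ := exists_bound_support_cone χ w
  obtain ⟨C, hC0, hC⟩ := exists_bound_testFunction χ
  refine (integrable_indicator_inv_norm_pow C (R + 1) one_le_two).mono' ?_ ?_
  · exact (Measurable.aestronglyMeasurable (by fun_prop)).mul
      (Continuous.aestronglyMeasurable (by fun_prop))
  · refine Eventually.of_forall fun y => ?_
    by_cases hy : y ∈ Metric.ball (0 : Space) (R + 1)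
    · rw [indicator_of_mem hy, norm_mul, mul_comm, pow_one, norm_inv, norm_norm]
      exact mul_le_mul_of_nonneg_right (hC _) (by positivity)
    · rw [indicator_of_notMem hy, hsupp y _ ?_, mul_zero, norm_zero]
      simp only [Metric.mem_ball, dist_zero_right, not_lt] at hy
      linarith

theorem potential_waveOp (ψ : 𝓓((⊤ : Opens SpaceTime), ℝ)) (w : SpaceTime) :
    potential (waveOp ψ) w = ψ w := by
  rw [potential, integral_waveOp_cone]
  have := Real.pi_pos
  field_simp

theorem potential_waveOp_expand (ψ : 𝓓((⊤ : Opens SpaceTime), ℝ)) (w : SpaceTime) :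
    potential (waveOp ψ) w = potential (∂_{timeDir} (∂_{timeDir} ψ)) w -
      ∑ i : Fin 3, potential (∂_{spaceDir i} (∂_{spaceDir i} ψ)) w := by
  simp only [potential, waveOp_apply, mul_sub, Finset.mul_sum]
  rw [integral_sub (integrable_cone _ w) (integrable_finsetSum _ fun i _ => integrable_cone _ w),
    integral_finsetSum _ fun i _ => integrable_cone _ w, mul_sub, Finset.mul_sum]

/-! ### Representation of the pressure wave by the potential. -/

/-- Smooth cutoff of the advanced potential, equal to it for `t > -1`. -/
def cutPotential (ψ : 𝓓((⊤ : Opens SpaceTime), ℝ)) : 𝓓((⊤ : Opens SpaceTime), ℝ) where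
  toFun w := Real.smoothTransition (w.2 + 2) * potential ψ w
  contDiff' := by
    refine ContDiff.mul ?_ (contDiff_potential ψ)
    exact Real.smoothTransition.contDiff.comp (by fun_prop)
  hasCompactSupport' := by
    obtain ⟨R, hR, hsupp⟩ := exists_bound_support ψ
    -- If `w.2 > -2` and `ψ` is nonzero at `w + (y, |y|)`, then `|y| < R + 2`, hence `‖w.1‖ < 2 R +
    -- 2`.
    refine HasCompactSupport.intro (isCompact_closedBall (0 : SpaceTime) (2 * R + 2)) fun w hw => ?_
    by_cases ht : w.2 ≤ -2
    · rw [Real.smoothTransition.zero_of_nonpos (by linarith), zero_mul]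
    · have hz : ∀ y : Space, ψ (w + (y, ‖y‖)) = 0 := by
        intro y
        by_contra hne
        have h1 : ‖w + (y, ‖y‖)‖ ≤ R := by
          by_contra h
          exact hne (hsupp _ (not_le.1 h))
        have h2 : ‖w.1 + y‖ ≤ R := (norm_fst_le (w + (y, ‖y‖))).trans h1
        have h3 : |w.2 + ‖y‖| ≤ R := (norm_snd_le (w + (y, ‖y‖))).trans h1
        have h4 := abs_le.1 h3
        have h5 : ‖w.1‖ ≤ ‖w.1 + y‖ + ‖y‖ := by simpa using norm_sub_le (w.1 + y) y
        have h6 := norm_nonneg y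
        apply hw
        rw [mem_closedBall_zero_iff, Prod.norm_def, max_le_iff, Real.norm_eq_abs, abs_le]
        refine ⟨?_, ?_, ?_⟩ <;> linarith
      simp [potential, hz]
  tsupport_subset' := subset_univ _

theorem cutPotential_apply_of_lt (ψ : 𝓓((⊤ : Opens SpaceTime), ℝ)) {w : SpaceTime}
    (hw : -1 < w.2) : cutPotential ψ w = potential ψ w := by
  change Real.smoothTransition (w.2 + 2) * potential ψ w = _
  rw [Real.smoothTransition.one_of_one_le (by linarith), one_mul]

theorem lineDerivOp_eq_potential {Φ ψ : 𝓓((⊤ : Opens SpaceTime), ℝ)} {O : Set SpaceTime}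
    (hO : IsOpen O) (h : ∀ w ∈ O, Φ w = potential ψ w) (v : SpaceTime) :
    ∀ w ∈ O, (∂_{v} Φ) w = potential (∂_{v} ψ) w := by
  intro w hw
  rw [lineDerivOp_eq_fderiv, ← fderiv_potential]
  have : (Φ : SpaceTime → ℝ) =ᶠ[𝓝 w] potential ψ := by
    filter_upwards [hO.mem_nhds hw] with z hz using h z hz
  rw [this.fderiv_eq]

/-- Test the wave equation with `cutPotential ψ`: its image under `waveOp` differs from `ψ` only
where `p` vanishes, and near `t = 0` the cutoff is invisible. -/
theorem IsPressureWave.apply_eq {f : Plane → ℝ} {p : SpaceTimeDistribution}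
    (hp : IsPressureWave f p) (ψ : 𝓓((⊤ : Opens SpaceTime), ℝ)) :
    p ψ = - ∫ ξ : Plane, f ξ * potential (∂_{timeDir} ψ) (spacePoint ξ 0, 0) := by
  have hO : IsOpen {w : SpaceTime | -1 < w.2} := isOpen_lt continuous_const continuous_snd
  have h0 : ∀ w ∈ {w : SpaceTime | -1 < w.2}, cutPotential ψ w = potential ψ w :=
    fun w hw => cutPotential_apply_of_lt ψ hw
  have h1 := fun v => lineDerivOp_eq_potential hO h0 v
  have h2 := fun v => lineDerivOp_eq_potential hO (h1 v) v
  have hwave : ∀ w : SpaceTime, -1 < w.2 → (waveOp (cutPotential ψ)) w = ψ w := by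
    intro w hw
    rw [waveOp_apply, h2 _ w hw, Finset.sum_congr rfl fun i _ => h2 (spaceDir i) w hw,
      ← potential_waveOp_expand, potential_waveOp]
  have hneg : p (waveOp (cutPotential ψ) - ψ) = 0 := by
    refine hp.eq_zero_of_neg _ ?_
    have hsub : tsupport (waveOp (cutPotential ψ) - ψ) ⊆ {y : SpaceTime | y.2 ≤ -1} := by
      refine closure_minimal (fun w hw => ?_) (isClosed_le continuous_snd continuous_const)
      by_contra hlt
      refine hw ?_
      change (waveOp (cutPotential ψ)) w - ψ w = 0
      rw [hwave w (not_le.1 hlt), sub_self]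
    exact hsub.trans fun w (hw : w.2 ≤ -1) => show w.2 < 0 by linarith
  have hw := hp.wave_eq (cutPotential ψ)
  rw [dAlembertian_apply, sheet] at hw
  rw [map_sub, sub_eq_zero] at hneg
  rw [← hneg, hw]
  congr 2
  ext ξ
  rw [h1 timeDir _ (by simp)]

/-! ### Circle integrals and polar coordinates in the plane. -/

/-- Arc length on the unit circle. -/
abbrev circleMeasure : Measure (Metric.sphere (0 : Plane) 1) := (volume : Measure Plane).toSphere

theorem circleMeasure_real_univ : circleMeasure.real univ = 2 * Real.pi := by
  rw [Measure.toSphere_real_apply_univ, Measure.real, EuclideanSpace.volume_ball_fin_two]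
  have := Real.pi_pos.le
  simp [this]

/-- Integral of `f` over the unit circle after `θ ↦ ξ + r θ`. -/
def circleIntegral (f : Plane → ℝ) (ξ : Plane) (r : ℝ) : ℝ :=
  ∫ θ : Metric.sphere (0 : Plane) 1, f (ξ + r • (θ : Plane)) ∂circleMeasure

/-- The radial derivative of `circleIntegral`. -/
def circleDeriv (f : Plane → ℝ) (ξ : Plane) (r : ℝ) : ℝ :=
  ∫ θ : Metric.sphere (0 : Plane) 1, fderiv ℝ f (ξ + r • (θ : Plane)) θ ∂circleMeasure

theorem sphericalMean_eq (f : Plane → ℝ) (ξ : Plane) (r : ℝ) :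
    sphericalMean f ξ r = (2 * Real.pi)⁻¹ * circleIntegral f ξ r := by
  rw [sphericalMean, circleMeasure_real_univ, circleIntegral]

theorem circleIntegral_zero (f : Plane → ℝ) (ξ : Plane) :
    circleIntegral f ξ 0 = 2 * Real.pi * f ξ := by
  simp only [circleIntegral, zero_smul, add_zero, integral_const, smul_eq_mul,
    circleMeasure_real_univ]

theorem continuous_circleIntegral {f : Plane → ℝ} (hf : Continuous f) :
    Continuous fun q : Plane × ℝ => circleIntegral f q.1 q.2 := by
  have h := continuous_parametric_integral_of_continuous (μ := circleMeasure)
    (f := fun (q : Plane × ℝ) (θ : Metric.sphere (0 : Plane) 1) => f (q.1 + q.2 • (θ : Plane)))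
    (by fun_prop) isCompact_univ
  simp only [Measure.restrict_univ] at h
  exact h

theorem continuous_circleDeriv {f : Plane → ℝ} (hf : ContDiff ℝ ∞ f) :
    Continuous fun q : Plane × ℝ => circleDeriv f q.1 q.2 := by
  have hf' : Continuous (fderiv ℝ f) := hf.continuous_fderiv (by simp)
  have h := continuous_parametric_integral_of_continuous (μ := circleMeasure)
    (f := fun (q : Plane × ℝ) (θ : Metric.sphere (0 : Plane) 1) =>
      fderiv ℝ f (q.1 + q.2 • (θ : Plane)) θ)
    (by
      change Continuous fun z : (Plane × ℝ) × Metric.sphere (0 : Plane) 1 =>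
        fderiv ℝ f (z.1.1 + z.1.2 • (z.2 : Plane)) z.2
      exact (hf'.comp (by fun_prop)).clm_apply (by fun_prop)) isCompact_univ
  simp only [Measure.restrict_univ] at h
  exact h

theorem hasDerivAt_circleIntegral {f : Plane → ℝ} (hf : ContDiff ℝ ∞ f)
    (hfc : HasCompactSupport f) (ξ : Plane) (r : ℝ) :
    HasDerivAt (circleIntegral f ξ) (circleDeriv f ξ r) r := by
  have hf' : Continuous (fderiv ℝ f) := hf.continuous_fderiv (by simp)
  obtain ⟨C, hC⟩ := hf'.bounded_above_of_compact_support (hfc.fderiv ℝ)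
  have hfcont := hf.continuous
  refine (hasDerivAt_integral_of_dominated_loc_of_deriv_le (μ := circleMeasure)
    (F := fun r (θ : Metric.sphere (0 : Plane) 1) => f (ξ + r • (θ : Plane)))
    (F' := fun r (θ : Metric.sphere (0 : Plane) 1) => fderiv ℝ f (ξ + r • (θ : Plane)) θ)
    (bound := fun _ => C) (s := univ) univ_mem ?_ ?_ ?_ ?_ (integrable_const C) ?_).2
  · exact Eventually.of_forall fun s => Continuous.aestronglyMeasurable (by fun_prop)
  · have : Continuous fun θ : Metric.sphere (0 : Plane) 1 => f (ξ + r • (θ : Plane)) := by fun_prop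
    exact this.integrable_of_hasCompactSupport (HasCompactSupport.of_compactSpace _)
  · exact Continuous.aestronglyMeasurable ((hf'.comp (by fun_prop)).clm_apply (by fun_prop))
  · refine Eventually.of_forall fun θ s _ => ?_
    refine ((fderiv ℝ f (ξ + s • (θ : Plane))).le_opNorm θ).trans ?_
    rw [norm_eq_of_mem_sphere, mul_one]
    exact hC _
  · refine Eventually.of_forall fun θ s _ => ?_
    have h1 : HasDerivAt (fun s : ℝ => ξ + s • (θ : Plane)) (θ : Plane) s := by
      simpa using ((hasDerivAt_id s).smul_const (θ : Plane)).const_add ξ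
    exact ((hf.differentiable (by simp)) _).hasFDerivAt.comp_hasDerivAt s h1

theorem integral_plane_polar {g : Plane → ℝ} (hg : Integrable g) :
    ∫ η : Plane, g η = ∫ r in Ioi (0 : ℝ), r *
      ∫ θ : Metric.sphere (0 : Plane) 1, g (r • (θ : Plane)) ∂circleMeasure := by
  have hmp := (volume : Measure Plane).measurePreserving_homeomorphUnitSphereProd
  have hemb := (homeomorphUnitSphereProd Plane).measurableEmbedding
  have hd : Module.finrank ℝ Plane - 1 = 1 := by simp
  rw [hd] at hmp
  let G : Metric.sphere (0 : Plane) 1 × Ioi (0 : ℝ) → ℝ := fun q => g ((q.2 : ℝ) • (q.1 : Plane))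
  have hG : ∀ x : ({0}ᶜ : Set Plane), G (homeomorphUnitSphereProd Plane x) = g x := by
    intro x
    have h := congrArg Subtype.val ((homeomorphUnitSphereProd Plane).symm_apply_apply x)
    exact congrArg g h
  have h1 : ∫ η : Plane, g η = ∫ q, G q ∂(circleMeasure.prod (Measure.volumeIoiPow 1)) := by
    rw [← hmp.integral_comp hemb]
    simp only [hG]
    rw [integral_subtype_comap (measurableSet_singleton (0 : Plane)).compl g,
      restrict_compl_singleton]
  have hGint : Integrable G (circleMeasure.prod (Measure.volumeIoiPow 1)) := by
    rw [← hmp.integrable_comp_emb hemb]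
    have : (G ∘ homeomorphUnitSphereProd Plane) = g ∘ Subtype.val := funext hG
    rw [this]
    exact (integrableOn_iff_comap_subtypeVal (measurableSet_singleton (0 : Plane)).compl).1
      hg.integrableOn
  rw [h1, integral_prod_symm _ hGint]
  simp only [Measure.volumeIoiPow, ENNReal.ofReal]
  rw [integral_withDensity_eq_integral_smul]
  · rw [integral_subtype_comap measurableSet_Ioi fun a : ℝ => Real.toNNReal (a ^ 1) •
      ∫ θ : Metric.sphere (0 : Plane) 1, g (a • (θ : Plane)) ∂circleMeasure]
    refine setIntegral_congr_fun measurableSet_Ioi fun x hx => ?_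
    simp only [NNReal.smul_def, pow_one, Real.coe_toNNReal _ (le_of_lt hx), smul_eq_mul]
  · exact (measurable_subtype_coe.pow_const _).real_toNNReal

/-! ### The density of the pressure wave above the plane. -/

/-- The orthogonal projection of space on the illumination plane. -/
def planeProj (x : Space) : Plane := !₂[x 0, x 1]

theorem continuous_planeProj : Continuous planeProj := by
  unfold planeProj
  fun_prop

theorem continuous_spacePoint_zero : Continuous fun ξ : Plane => spacePoint ξ 0 := by
  unfold spacePoint
  fun_prop

theorem norm_sub_spacePoint (x : Space) (η : Plane) :
    ‖x - spacePoint (planeProj x + η) 0‖ = √(‖η‖ ^ 2 + x 2 ^ 2) := by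
  rw [EuclideanSpace.norm_eq, EuclideanSpace.norm_sq_eq, Fin.sum_univ_three, Fin.sum_univ_two]
  simp [spacePoint, planeProj]

/-- The space-time points `(x, t)` with `t` greater than the distance of `x` from the illumination
plane. -/
def coneInterior : Set SpaceTime := {w | |w.1 2| < w.2}

theorem isOpen_coneInterior : IsOpen coneInterior :=
  isOpen_lt (by fun_prop) (by fun_prop)

/-- The density of the pressure wave on `coneInterior`: half the time derivative of the circular
mean `M₂[f](ξ; √(t² - z²))`. -/
def waveDensity (f : Plane → ℝ) (w : SpaceTime) : ℝ :=
  (4 * Real.pi)⁻¹ * (circleDeriv f (planeProj w.1) √(w.2 ^ 2 - w.1 2 ^ 2) *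
    (w.2 / √(w.2 ^ 2 - w.1 2 ^ 2)))

theorem sub_sq_pos {z t : ℝ} (h : |z| < t) : 0 < t ^ 2 - z ^ 2 := by
  have := sq_lt_sq' (by linarith [neg_abs_le z, abs_nonneg z]) h
  rw [sq_abs] at this
  linarith

theorem continuousOn_waveDensity {f : Plane → ℝ} (hf : ContDiff ℝ ∞ f) :
    ContinuousOn (waveDensity f) coneInterior := by
  have hs : Continuous fun w : SpaceTime => √(w.2 ^ 2 - w.1 2 ^ 2) := by fun_prop
  have h1 : Continuous fun w : SpaceTime =>
      circleDeriv f (planeProj w.1) √(w.2 ^ 2 - w.1 2 ^ 2) :=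
    (continuous_circleDeriv hf).comp ((continuous_planeProj.comp continuous_fst).prodMk hs)
  refine continuousOn_const.mul (h1.continuousOn.mul
    (continuous_snd.continuousOn.div hs.continuousOn fun w hw => ?_))
  exact (Real.sqrt_pos.2 (sub_sq_pos hw)).ne'

/-- The density is singular on `|z| = t`, but `ψ` vanishes near that boundary. -/
theorem continuous_waveDensity_mul {f : Plane → ℝ} (hf : ContDiff ℝ ∞ f)
    {ψ : 𝓓((⊤ : Opens SpaceTime), ℝ)} (hψ : tsupport ψ ⊆ coneInterior) :
    Continuous fun w => waveDensity f w * ψ w :=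
  ((continuousOn_waveDensity hf).mul ψ.continuous.continuousOn).continuous_of_tsupport_subset
    isOpen_coneInterior ((closure_mono (Function.support_mul_subset_right _ _)).trans hψ)

/-- Integration by parts in `t`; up to the factor `4π`, `waveDensity` is the `t`-derivative of the
circle integral. Both boundary terms vanish, since `(x, |z|)` lies off the support of `ψ` and that
support is compact. -/
theorem integral_circleIntegral_mul {f : Plane → ℝ} (hf : ContDiff ℝ ∞ f)
    (hfc : HasCompactSupport f) {ψ : 𝓓((⊤ : Opens SpaceTime), ℝ)}
    (hψ : tsupport ψ ⊆ coneInterior) (x : Space) :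
    ∫ t in Ioi |x 2|, circleIntegral f (planeProj x) √(t ^ 2 - x 2 ^ 2) * (∂_{timeDir} ψ) (x, t) =
      - (4 * Real.pi * ∫ t : ℝ, waveDensity f (x, t) * ψ (x, t)) := by
  have hpi := Real.pi_pos
  set χ := ∂_{timeDir} ψ with hχ
  have hcompact : ∀ (ζ : 𝓓((⊤ : Opens SpaceTime), ℝ)) (h : ℝ → ℝ),
      HasCompactSupport fun t : ℝ => h t * ζ (x, t) := by
    intro ζ h
    obtain ⟨R, hR, hsupp⟩ := exists_bound_support ζ
    refine HasCompactSupport.intro (isCompact_closedBall (0 : ℝ) R) fun t ht => ?_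
    rw [hsupp, mul_zero]
    rw [mem_closedBall_zero_iff, not_le] at ht
    exact ht.trans_le (norm_snd_le (x, t))
  have hu : Continuous fun t : ℝ => circleIntegral f (planeProj x) √(t ^ 2 - x 2 ^ 2) :=
    (continuous_circleIntegral hf.continuous).comp (continuous_const.prodMk (by fun_prop))
  have hzero : ∀ t : ℝ, t ∉ Ioi |x 2| → ψ (x, t) = 0 := fun t ht =>
    image_eq_zero_of_notMem_tsupport fun h => ht (hψ h)
  have hg : Continuous fun t : ℝ => waveDensity f (x, t) * ψ (x, t) :=
    (continuous_waveDensity_mul hf hψ).comp (by fun_prop : Continuous fun t : ℝ => (x, t))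
  have huv : Continuous fun t : ℝ => circleIntegral f (planeProj x) √(t ^ 2 - x 2 ^ 2) * ψ (x, t) :=
    hu.mul (by fun_prop)
  have hibp := integral_Ioi_mul_deriv_eq_deriv_mul (a := |x 2|) (a' := 0) (b' := 0)
    (u := fun t => circleIntegral f (planeProj x) √(t ^ 2 - x 2 ^ 2))
    (u' := fun t => 4 * Real.pi * waveDensity f (x, t))
    (v := fun t => ψ (x, t)) (v' := fun t => χ (x, t)) ?_ ?_ ?_ ?_ ?_ ?_
  · rw [hibp, sub_zero, zero_sub]
    simp only [mul_assoc]
    rw [integral_const_mul, integral_const_mul,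
      setIntegral_eq_integral_of_forall_compl_eq_zero fun t ht => by rw [hzero t ht, mul_zero]]
  · intro t ht
    have hp := sub_sq_pos ht
    have hs := Real.sqrt_pos.2 hp
    have h1 : HasDerivAt (fun t : ℝ => √(t ^ 2 - x 2 ^ 2)) (t / √(t ^ 2 - x 2 ^ 2)) t := by
      refine ((((hasDerivAt_id t).pow 2).sub_const (x 2 ^ 2)).sqrt hp.ne').congr_deriv ?_
      simp
      field_simp
    refine ((hasDerivAt_circleIntegral hf hfc (planeProj x) _).comp t h1).congr_deriv ?_
    simp only [waveDensity]
    field_simp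
  · intro t _
    have h1 : HasDerivAt (fun t : ℝ => ((x, t) : SpaceTime)) timeDir t :=
      (hasDerivAt_const t x).prodMk (hasDerivAt_id t)
    have h2 := (hasFDerivAt_testFunction ψ (x, t)).comp_hasDerivAt t h1
    rw [hχ, lineDerivOp_eq_fderiv]
    exact h2
  · exact ((hu.mul (by fun_prop)).integrable_of_hasCompactSupport
      (hcompact χ _)).integrableOn
  · have h1 : ((fun t => 4 * Real.pi * waveDensity f (x, t)) * fun t => ψ (x, t)) =
        fun t : ℝ => 4 * Real.pi * (waveDensity f (x, t) * ψ (x, t)) := by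
      ext t
      simp only [Pi.mul_apply, mul_assoc]
    rw [h1]
    exact ((hg.integrable_of_hasCompactSupport (hcompact ψ _)).const_mul _).integrableOn
  · have h1 := (huv.tendsto |x 2|).mono_left (nhdsWithin_le_nhds (s := Ioi |x 2|))
    rw [hzero _ self_notMem_Ioi, mul_zero] at h1
    exact h1
  · have h1 := hcompact ψ fun t => circleIntegral f (planeProj x) √(t ^ 2 - x 2 ^ 2)
    rw [hasCompactSupport_iff_eventuallyEq, Filter.coclosedCompact_eq_cocompact] at h1
    exact (h1.filter_mono _root_.atTop_le_cocompact).tendsto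

/-- In polar coordinates around `planeProj x`, the substitution `ρ = √(r² + z²)` has `dρ = r dr /
ρ`, which uses up both the polar weight `r` and the kernel `1/ρ`. Integrability is assumed for the
given `x` because Fubini provides it only for almost every `x`. -/
theorem integral_layer {f : Plane → ℝ} (hf : ContDiff ℝ ∞ f)
    (hfc : HasCompactSupport f) {ψ : 𝓓((⊤ : Opens SpaceTime), ℝ)}
    (hψ : tsupport ψ ⊆ coneInterior) (x : Space)
    (hint : Integrable fun ξ : Plane => f ξ * (‖x - spacePoint ξ 0‖⁻¹ *
      (∂_{timeDir} ψ) (x, ‖x - spacePoint ξ 0‖))) :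
    ∫ ξ : Plane, f ξ * (‖x - spacePoint ξ 0‖⁻¹ * (∂_{timeDir} ψ) (x, ‖x - spacePoint ξ 0‖)) =
      - (4 * Real.pi * ∫ t : ℝ, waveDensity f (x, t) * ψ (x, t)) := by
  set χ := ∂_{timeDir} ψ with hχ
  rw [← integral_circleIntegral_mul hf hfc hψ x]
  set z := x 2 with hz
  set G : ℝ → ℝ := fun t => circleIntegral f (planeProj x) √(t ^ 2 - z ^ 2) * χ (x, t) with hGdef
  obtain ⟨R, hR, hsupp⟩ := exists_bound_support χ
  have hGzero : ∀ t : ℝ, R < |t| → G t = 0 := by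
    intro t ht
    rw [hGdef]
    simp only
    rw [hsupp, mul_zero]
    exact ht.trans_le (norm_snd_le (x, t))
  have hGc : Continuous G := by
    refine Continuous.mul ?_ (by fun_prop)
    exact (continuous_circleIntegral hf.continuous).comp (continuous_const.prodMk (by fun_prop))
  have hGint : Integrable G := hGc.integrable_of_hasCompactSupport <|
    HasCompactSupport.intro (isCompact_closedBall (0 : ℝ) R) fun t ht => hGzero t (by simpa using ht)
  have hint' : Integrable fun η : Plane => f (planeProj x + η) *
      ((√(‖η‖ ^ 2 + z ^ 2))⁻¹ * χ (x, √(‖η‖ ^ 2 + z ^ 2))) := by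
    have := hint.comp_add_left (planeProj x)
    simpa only [norm_sub_spacePoint] using this
  rw [← integral_add_left_eq_self _ (planeProj x)]
  simp only [norm_sub_spacePoint]
  rw [integral_plane_polar hint']
  have hρ0 : √((0 : ℝ) ^ 2 + z ^ 2) = |z| := by simp [Real.sqrt_sq_eq_abs]
  have hρc : Continuous fun r : ℝ => √(r ^ 2 + z ^ 2) := by fun_prop
  have hρle : ∀ r : ℝ, |r| ≤ √(r ^ 2 + z ^ 2) := fun r => by
    rw [← Real.sqrt_sq_eq_abs]
    exact Real.sqrt_le_sqrt (by nlinarith [sq_nonneg z])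
  have hcov := integral_comp_mul_deriv_Ioi (f := fun r : ℝ => √(r ^ 2 + z ^ 2))
    (f' := fun r => r / √(r ^ 2 + z ^ 2)) (g := G) (a := 0) hρc.continuousOn
    (tendsto_atTop_mono (fun r => (le_abs_self r).trans (hρle r)) tendsto_id) ?_ hGc.continuousOn
    hGint.integrableOn ?_
  · rw [hρ0] at hcov
    rw [← hcov]
    refine setIntegral_congr_fun measurableSet_Ioi fun r hr => ?_
    have hr0 : (0 : ℝ) < r := hr
    have hn : ∀ θ : Metric.sphere (0 : Plane) 1, ‖r • (θ : Plane)‖ = r := fun θ => by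
      rw [norm_smul, norm_eq_of_mem_sphere, mul_one, Real.norm_of_nonneg hr0.le]
    simp only [hn]
    rw [integral_mul_const]
    simp only [Function.comp_apply, hGdef]
    rw [Real.sq_sqrt (by positivity), add_sub_cancel_right, Real.sqrt_sq hr0.le, circleIntegral]
    ring
  · intro r hr
    have hr0 : (0 : ℝ) < r := hr
    have hp : 0 < r ^ 2 + z ^ 2 := by positivity
    refine HasDerivAt.hasDerivWithinAt ?_
    refine ((((hasDerivAt_id r).pow 2).add_const (z ^ 2)).sqrt hp.ne').congr_deriv ?_
    simp
    field_simp
  · have h1 : Integrable (G ∘ fun r : ℝ => √(r ^ 2 + z ^ 2)) := by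
      refine (hGc.comp hρc).integrable_of_hasCompactSupport <|
        HasCompactSupport.intro (isCompact_closedBall (0 : ℝ) R) fun r hr => hGzero _ ?_
      rw [mem_closedBall_zero_iff, not_le, Real.norm_eq_abs] at hr
      exact hr.trans_le ((hρle r).trans (le_abs_self _))
    refine (h1.mul_bdd (c := 1) (Measurable.aestronglyMeasurable (by fun_prop))
      (Eventually.of_forall fun r => ?_)).integrableOn
    rw [norm_div, Real.norm_eq_abs, Real.norm_of_nonneg (Real.sqrt_nonneg _)]
    exact div_le_one_of_le₀ (hρle r) (Real.sqrt_nonneg _)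

/-- Justifies the exchange of integrals. After the measure-preserving shear `x = y + (ξ, 0)` the
integrand is bounded by `|f(ξ)|` times an integrable function of `y`. -/
theorem integrable_layer_cone {f : Plane → ℝ} (hf : Integrable f)
    (χ : 𝓓((⊤ : Opens SpaceTime), ℝ)) :
    Integrable (fun q : Plane × Space => f q.1 * (‖q.2 - spacePoint q.1 0‖⁻¹ *
      χ (q.2, ‖q.2 - spacePoint q.1 0‖))) ((volume : Measure Plane).prod volume) := by
  obtain ⟨R, hR, hsupp⟩ := exists_bound_support χ
  obtain ⟨C, hC0, hC⟩ := exists_bound_testFunction χ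
  have hP := continuous_spacePoint_zero
  have hF : Integrable (fun q : Plane × Space => f q.1 * (‖q.2‖⁻¹ *
      χ (q.2 + spacePoint q.1 0, ‖q.2‖))) ((volume : Measure Plane).prod volume) := by
    refine (hf.norm.mul_prod
      (integrable_indicator_inv_norm_pow C (R + 1) one_le_two)).mono' ?_ ?_
    · have h1 : Continuous fun q : Plane × Space => χ (q.2 + spacePoint q.1 0, ‖q.2‖) := by fun_prop
      exact hf.aestronglyMeasurable.comp_fst.mul
        ((Measurable.aestronglyMeasurable (by fun_prop)).mul h1.aestronglyMeasurable)
    · refine Eventually.of_forall fun q => ?_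
      rw [norm_mul]
      refine mul_le_mul_of_nonneg_left ?_ (norm_nonneg _)
      by_cases hy : q.2 ∈ Metric.ball (0 : Space) (R + 1)
      · rw [indicator_of_mem hy, norm_mul, mul_comm, pow_one, norm_inv, norm_norm]
        exact mul_le_mul_of_nonneg_right (hC _) (by positivity)
      · rw [indicator_of_notMem hy, hsupp, mul_zero, norm_zero]
        simp only [Metric.mem_ball, dist_zero_right, not_lt] at hy
        have := norm_snd_le ((q.2 + spacePoint q.1 0, ‖q.2‖) : SpaceTime)
        rw [norm_norm] at this
        linarith
  have hshear : MeasurePreserving (fun q : Plane × Space => (q.1, q.2 - spacePoint q.1 0))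
      ((volume : Measure Plane).prod volume) ((volume : Measure Plane).prod volume) := by
    refine (MeasurePreserving.id _).skew_product (g := fun ξ y => y - spacePoint ξ 0)
      (Continuous.measurable ?_) (Eventually.of_forall fun ξ => ?_)
    · change Continuous fun q : Plane × Space => q.2 - spacePoint q.1 0
      fun_prop
    · exact (measurePreserving_sub_right volume (spacePoint ξ 0)).map_eq
  have h := hshear.integrable_comp_of_integrable hF
  simpa only [Function.comp_def, sub_add_cancel] using h

theorem IsPressureWave.apply_eq_integral {f : Plane → ℝ} {p : SpaceTimeDistribution}
    (hp : IsPressureWave f p) (hf : ContDiff ℝ ∞ f) (hfc : HasCompactSupport f)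
    {ψ : 𝓓((⊤ : Opens SpaceTime), ℝ)} (hψ : tsupport ψ ⊆ coneInterior) :
    p ψ = ∫ w : SpaceTime, waveDensity f w * ψ w := by
  have hpi := Real.pi_pos
  have hfint : Integrable f := hf.continuous.integrable_of_hasCompactSupport hfc
  have hK := integrable_layer_cone hfint (∂_{timeDir} ψ)
  have hgint : Integrable (fun w => waveDensity f w * ψ w) :=
    (continuous_waveDensity_mul hf hψ).integrable_of_hasCompactSupport ψ.hasCompactSupport.mul_left
  have hpot : ∀ ξ : Plane, f ξ * potential (∂_{timeDir} ψ) (spacePoint ξ 0, 0) =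
      (4 * Real.pi)⁻¹ * ∫ x : Space, f ξ * (‖x - spacePoint ξ 0‖⁻¹ *
        (∂_{timeDir} ψ) (x, ‖x - spacePoint ξ 0‖)) := by
    intro ξ
    have hx := integral_add_left_eq_self (μ := (volume : Measure Space))
      (fun x : Space => ‖x - spacePoint ξ 0‖⁻¹ * (∂_{timeDir} ψ) (x, ‖x - spacePoint ξ 0‖))
      (spacePoint ξ 0)
    rw [integral_const_mul, potential, ← hx]
    simp only [add_sub_cancel_left, Prod.mk_add_mk, zero_add]
    ring
  rw [hp.apply_eq]
  simp only [hpot]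
  rw [integral_const_mul, integral_integral_swap hK,
    integral_congr_ae (hK.prod_left_ae.mono fun x hx => integral_layer hf hfc hψ x hx),
    integral_neg, integral_const_mul, Measure.volume_eq_prod, integral_prod _ hgint]
  field_simp

/-! ### Point values and the detector data. -/

/-- Two continuous densities of the same distribution agree almost everywhere on the common open
set, hence everywhere there. This identifies the value chosen in `pointValue`. -/
theorem HasPointValue.unique {p : SpaceTimeDistribution} {y : SpaceTime} {v v' : ℝ}
    (h : HasPointValue p y v) (h' : HasPointValue p y v') : v = v' := by
  obtain ⟨U, g, hU, hyU, hg, hpg, rfl⟩ := h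
  obtain ⟨U', g', hU', hyU', hg', hpg', rfl⟩ := h'
  have hO := hU.inter hU'
  have hgO := hg.mono (inter_subset_left (t := U'))
  have hgO' := hg'.mono (inter_subset_right (s := U))
  have hint : ∀ {k : SpaceTime → ℝ}, ContinuousOn k (U ∩ U') → ∀ {φ : SpaceTime → ℝ},
      Continuous φ → HasCompactSupport φ → tsupport φ ⊆ U ∩ U' → Integrable fun w => k w * φ w := by
    intro k hk φ hφ hφc hφs
    refine Continuous.integrable_of_hasCompactSupport ?_ hφc.mul_left
    exact (hk.mul hφ.continuousOn).continuous_of_tsupport_subset hO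
      ((closure_mono (Function.support_mul_subset_right _ _)).trans hφs)
  have hae := hO.ae_eq_zero_of_integral_contDiff_smul_eq_zero (μ := volume)
    (f := fun w => g w - g' w) ((hgO.sub hgO').locallyIntegrableOn hO.measurableSet) ?_
  · have h0 : (fun w => g w - g' w) =ᵐ[volume.restrict (U ∩ U')] fun _ => 0 :=
      (ae_restrict_iff' hO.measurableSet).2 hae
    exact sub_eq_zero.1 (Measure.eqOn_open_of_ae_eq h0 hO (hgO.sub hgO') continuousOn_const
      ⟨hyU, hyU'⟩)
  · intro φ hφ hφc hφs
    let ψ : 𝓓((⊤ : Opens SpaceTime), ℝ) := ⟨φ, hφ, hφc, subset_univ _⟩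
    have h1 : p ψ = ∫ w, g w * φ w := hpg ψ (hφs.trans inter_subset_left)
    have h2 : p ψ = ∫ w, g' w * φ w := hpg' ψ (hφs.trans inter_subset_right)
    have h3 : (fun w => φ w • (g w - g' w)) = fun w => g w * φ w - g' w * φ w := by
      ext w
      rw [smul_eq_mul]
      ring
    rw [h3, integral_sub (hint hgO hφ.continuous hφc hφs) (hint hgO' hφ.continuous hφc hφs),
      ← h1, ← h2, sub_self]

theorem HasPointValue.pointValue_eq {p : SpaceTimeDistribution} {y : SpaceTime} {v : ℝ}
    (h : HasPointValue p y v) : pointValue p y = v := by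
  have hex : ∃ v : ℝ, HasPointValue p y v := ⟨v, h⟩
  rw [pointValue, dif_pos hex]
  exact hex.choose_spec.unique h

theorem planeProj_spacePoint (ξ : Plane) (z : ℝ) : planeProj (spacePoint ξ z) = ξ := by
  ext i
  fin_cases i <;> simp [planeProj, spacePoint]

theorem IsPressureWave.hasPointValue {f : Plane → ℝ} {p : SpaceTimeDistribution}
    (hp : IsPressureWave f p) (hf : ContDiff ℝ ∞ f) (hfc : HasCompactSupport f)
    (ξ : Plane) {t : ℝ} (ht : 0 < t) :
    HasPointValue p (spacePoint ξ 0, t) ((4 * Real.pi)⁻¹ * circleDeriv f ξ t) := by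
  refine ⟨coneInterior, waveDensity f, isOpen_coneInterior, ?_, continuousOn_waveDensity hf,
    fun ψ hψ => hp.apply_eq_integral hf hfc hψ, ?_⟩
  · simpa [coneInterior, spacePoint] using ht
  · have h2 : spacePoint ξ 0 2 = 0 := by simp [spacePoint]
    simp only [waveDensity, planeProj_spacePoint, h2]
    rw [zero_pow two_ne_zero, sub_zero, Real.sqrt_sq ht.le, div_self ht.ne', mul_one]

theorem IsPressureWave.pointData_eq {f : Plane → ℝ} {p : SpaceTimeDistribution}
    (hp : IsPressureWave f p) (hf : ContDiff ℝ ∞ f) (hfc : HasCompactSupport f)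
    (ξ : Plane) {t : ℝ} (ht : 0 < t) :
    pointData p ξ t = (4 * Real.pi)⁻¹ * circleDeriv f ξ t :=
  (hp.hasPointValue hf hfc ξ ht).pointValue_eq

theorem IsPressureWave.intervalIntegrable_pointData {f : Plane → ℝ} {p : SpaceTimeDistribution}
    (hp : IsPressureWave f p) (hf : ContDiff ℝ ∞ f) (hfc : HasCompactSupport f)
    (ξ : Plane) {t : ℝ} (ht : 0 < t) :
    IntervalIntegrable (fun s : ℝ => pointData p ξ s) volume 0 t := by
  have hc : Continuous fun s : ℝ => (4 * Real.pi)⁻¹ * circleDeriv f ξ s :=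
    continuous_const.mul ((continuous_circleDeriv hf).comp (continuous_const.prodMk continuous_id))
  refine (hc.intervalIntegrable 0 t).congr fun s hs => ?_
  -- The half-open interval omits `s = 0`, where the formula for `pointData` is not available.
  rw [uIoc_of_le ht.le] at hs
  exact (hp.pointData_eq hf hfc ξ hs.1).symm

theorem IsPressureWave.two_mul_integral_pointData {f : Plane → ℝ} {p : SpaceTimeDistribution}
    (hp : IsPressureWave f p) (hf : ContDiff ℝ ∞ f) (hfc : HasCompactSupport f)
    (ξ : Plane) {t : ℝ} (ht : 0 < t) :
    2 * ∫ s in (0 : ℝ)..t, pointData p ξ s = sphericalMean f ξ t - f ξ := by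
  have hpi := Real.pi_pos
  have hc : Continuous (circleDeriv f ξ) :=
    (continuous_circleDeriv hf).comp (continuous_const.prodMk continuous_id)
  have h1 : ∫ s in (0 : ℝ)..t, pointData p ξ s =
      ∫ s in (0 : ℝ)..t, (4 * Real.pi)⁻¹ * circleDeriv f ξ s := by
    rw [intervalIntegral.integral_of_le ht.le, intervalIntegral.integral_of_le ht.le]
    exact setIntegral_congr_fun measurableSet_Ioc fun s hs => hp.pointData_eq hf hfc ξ hs.1
  rw [h1, intervalIntegral.integral_const_mul, intervalIntegral.integral_eq_sub_of_hasDerivAt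
    (fun s _ => hasDerivAt_circleIntegral hf hfc ξ s) (hc.intervalIntegrable 0 t),
    circleIntegral_zero, sphericalMean_eq]
  field_simp
  ring

end Photoacoustic

end

theorem mainTheorem3 (Ω : Set Photoacoustic.Plane) (hΩ : IsOpen Ω)
    (f : Photoacoustic.Plane → ℝ) (hf : ContDiff ℝ ∞ f) (hfc : HasCompactSupport f)
    (hfΩ : tsupport f ⊆ Ω)
    (p : Photoacoustic.SpaceTimeDistribution) (hp : Photoacoustic.IsPressureWave f p) :
    (∀ ξ ∈ frontier Ω, ∀ t : ℝ, 0 < t →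
      Photoacoustic.HasPointValue p (Photoacoustic.spacePoint ξ 0, t)
        (Photoacoustic.pointData p ξ t) ∧
      IntervalIntegrable (fun s : ℝ => Photoacoustic.pointData p ξ s) volume 0 t ∧
      Photoacoustic.sphericalMean f ξ t =
        2 * ∫ s in (0 : ℝ)..t, Photoacoustic.pointData p ξ s) ∧
    (∀ R : (frontier Ω → Ioi (0 : ℝ) → ℝ) → (Photoacoustic.Plane → ℝ),
      (∀ g : Photoacoustic.Plane → ℝ, ContDiff ℝ ∞ g → HasCompactSupport g → tsupport g ⊆ Ω →
        R (fun ξ t => Photoacoustic.sphericalMean g ξ t) = g) →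
      R (fun ξ t => 2 * ∫ s in (0 : ℝ)..t, Photoacoustic.pointData p ξ s) = f) := by
  -- An open set is disjoint from its frontier, so the initial value drops out there.
  have hzero : ∀ ξ ∈ frontier Ω, f ξ = 0 := fun ξ hξ =>
    image_eq_zero_of_notMem_tsupport fun h => by
      rw [hΩ.frontier_eq] at hξ
      exact hξ.2 (hfΩ h)
  have hmean : ∀ ξ ∈ frontier Ω, ∀ t : ℝ, 0 < t → Photoacoustic.sphericalMean f ξ t =
      2 * ∫ s in (0 : ℝ)..t, Photoacoustic.pointData p ξ s := fun ξ hξ t ht => by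
    rw [hp.two_mul_integral_pointData hf hfc ξ ht, hzero ξ hξ, sub_zero]
  refine ⟨fun ξ hξ t ht => ⟨?_, hp.intervalIntegrable_pointData hf hfc ξ ht, hmean ξ hξ t ht⟩,
    fun R hR => ?_⟩
  · rw [hp.pointData_eq hf hfc ξ ht]
    exact hp.hasPointValue hf hfc ξ ht
  · have h : (fun (ξ : frontier Ω) (t : Ioi (0 : ℝ)) =>
        2 * ∫ s in (0 : ℝ)..t, Photoacoustic.pointData p ξ s) =
        fun (ξ : frontier Ω) (t : Ioi (0 : ℝ)) => Photoacoustic.sphericalMean f ξ t := by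
      ext ξ t
      exact (hmean ξ ξ.2 t t.2).symm
    rw [h]
    exact hR f hf hfc hfΩ
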